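/- Let $d\ge 1$ be an integer and let $|\cdot|$ be the Euclidean norm on $\mathbb R^d$. Put $c_d=2\pi^{d/2}/\Gamma(d/2)$ (the surface area of the unit sphere of $\mathbb R^d$), and let $\chi_d=d-2$ for $d>2$ and $\chi_d=1$ for $d=1,2$. For $r>0$ let $$\Phi_d(r)=\begin{cases}-r,& d=1,\\ -\log r,& d=2,\\ r^{2-d},& d>2,\end{cases}$$ and let $\Phi_d(\vec r,\vec r\,')=\Phi_d(|\vec r-\vec r\,'|)$ be the Coulomb potential between unit charges at distinct points $\vec r,\vec r\,'\in\mathbb R^d$. Let $R>0$, let $B_R=\{\vec r\in\mathbb R^d:|\vec r|<R\}$, and let $B_R$ be filled with a uniform charge of density $-\rho_b$, $\rho_b\in\mathbb R$, of total charge $-N$, i.e. $N=\rho_b|B_R|$, where $|B_R|$ is the volume of the ball. Then for every $\vec r\in\mathbb R^d$ the integral defining the electrostatic potential $$V(\vec r)=\int_{B_R}\Phi_d(\vec r,\vec r\,')\,(-\rho_b)\,d\vec r\,'$$ converges absolutely, and with $r=|\vec r|$ $$V(\vec r)=\begin{cases}\rho_b\,\dfrac{c_d\chi_d}{2d}\,(r^2-R^2)-N\,\Phi_d(R),&\vec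 r\in B_R,\\[2mm] -N\,\Phi_d(r),&\vec r\notin B_R.\end{cases}$$ -/

import Mathlib

namespace CoulombGas

/-- The surface area `c_d = 2 π^{d/2} / Γ(d/2)` of the unit sphere in `ℝ^d`. -/
noncomputable def sphereArea (d : ℕ) : ℝ :=
  2 * Real.pi ^ ((d : ℝ) / 2) / Real.Gamma ((d : ℝ) / 2)

/-- The constant `χ_d`: equal to `d - 2` for `d > 2`, and to `1` otherwise. -/
noncomputable def chi (d : ℕ) : ℝ :=
  if 2 < d then (d : ℝ) - 2 else 1

/-- The radial profile `Φ_d(r)` of the Coulomb potential of a unit charge in `ℝ^d`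
(the first branch is only used for `d = 1`). -/
noncomputable def radialPhi (d : ℕ) (r : ℝ) : ℝ :=
  if d < 2 then -r
  else if d = 2 then -Real.log r
  else r ^ (2 - (d : ℝ))

/-- The Coulomb pair potential `Φ_d(x, x')` of two unit charges at `x, x' ∈ ℝ^d`:
`-|x - x'|` for `d = 1`, `-log |x - x'|` for `d = 2`, and `|x - x'|^{2-d}` for `d > 2`. -/
noncomputable def Phi {d : ℕ} (x x' : EuclideanSpace ℝ (Fin d)) : ℝ :=
  radialPhi d ‖x - x'‖

/-- `Φ_d(r) = Φ_d(x, 0)` for any vector `x` with `|x| = r`. -/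
theorem radialPhi_eq_Phi {d : ℕ} {r : ℝ} {x : EuclideanSpace ℝ (Fin d)} (hx : ‖x‖ = r) :
    radialPhi d r = Phi x 0 := by
  simp [Phi, hx]

/-- The electrostatic potential `V(x) = ∫_Ω Φ_d(x, x') C(x') dx'` of a charge density `C` on a
domain `Ω`. -/
noncomputable def potential {d : ℕ} (Ω : Set (EuclideanSpace ℝ (Fin d)))
    (C : EuclideanSpace ℝ (Fin d) → ℝ) (x : EuclideanSpace ℝ (Fin d)) : ℝ :=
  ∫ x' in Ω, Phi x x' * C x'

end CoulombGas

open MeasureTheory Set Metric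
open scoped RealInnerProductSpace

namespace CoulombGas

/-! ### Polar coordinates and Fubini in both orders. -/

section Polar

variable {E : Type*} [NormedAddCommGroup E] [NormedSpace ℝ E] [MeasurableSpace E]

/-! For `d ≠ 2` the potential is a multiple of the integral of `‖x - y‖ ^ (2 - d)`. At an interior
point, use polar coordinates centred at `x`: the weight `t ^ (d - 1)` turns the kernel into `t`, so
each direction contributes half the squared distance to the boundary. Averaging with `-x` cancels
the square roots and leaves a quadratic in `⟪x, ω⟫`, whose spherical integral follows from symmetry
(`integral_sphere_inner_sq`).

Newton's theorem is then deduced from the interior formula. Differentiating that formula in the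
radius gives the mean of the kernel over a sphere enclosing a point
(`integral_sphere_norm_sub_rpow`). The identity `norm_sub_smul_eq_norm_smul_sub` exchanges the two
radii, which gives the mean over a sphere seen from outside; integrating over shells gives the
exterior potential.

For `d = 2` the kernel is logarithmic. The plane is identified with `ℂ`, and Jensen's circle average
`log (max t ‖a‖)` is integrated over the radius. -/

theorem integral_volumeIoiPow (n : ℕ) (g : ℝ → ℝ) :
    ∫ t : Ioi (0 : ℝ), g t ∂(Measure.volumeIoiPow n) = ∫ t in Ioi (0 : ℝ), t ^ n * g t := by
  simp only [Measure.volumeIoiPow, ENNReal.ofReal]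
  rw [integral_withDensity_eq_integral_smul,
    integral_subtype_comap measurableSet_Ioi fun a ↦ Real.toNNReal (a ^ n) • g a,
    setIntegral_congr_fun measurableSet_Ioi fun x hx ↦ ?_]
  · rw [NNReal.smul_def, Real.coe_toNNReal _ (pow_nonneg (le_of_lt hx) _), smul_eq_mul]
  · exact (measurable_subtype_coe.pow_const _).real_toNNReal

theorem integrable_volumeIoiPow_iff (n : ℕ) (g : ℝ → ℝ) :
    Integrable (fun t : Ioi (0 : ℝ) ↦ g t) (Measure.volumeIoiPow n) ↔
      IntegrableOn (fun t ↦ t ^ n * g t) (Ioi 0) := by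
  rw [integrableOn_iff_comap_subtypeVal measurableSet_Ioi, Measure.volumeIoiPow,
    integrable_withDensity_iff_integrable_smul' (by fun_prop) (by simp)]
  refine integrable_congr (.of_forall ?_)
  rintro ⟨t, ht : 0 < t⟩
  simp (disch := positivity) [ENNReal.toReal_ofReal]

variable [FiniteDimensional ℝ E] [BorelSpace E]
  (μ : Measure E) [μ.IsAddHaarMeasure]

theorem integrable_polar {f : E → ℝ} (hf : Integrable f μ) :
    Integrable (fun p : sphere (0 : E) 1 × Ioi (0 : ℝ) ↦ f (p.2.1 • p.1.1))
      (μ.toSphere.prod (Measure.volumeIoiPow (Module.finrank ℝ E - 1))) := by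
  rw [← μ.measurePreserving_homeomorphUnitSphereProd.integrable_comp_emb
    (Homeomorph.measurableEmbedding _)]
  have h : IntegrableOn f {(0 : E)}ᶜ μ := hf.integrableOn
  rw [integrableOn_iff_comap_subtypeVal (by measurability)] at h
  refine h.congr (.of_forall fun x ↦ ?_)
  have hx : ‖(x : E)‖ ≠ 0 := norm_ne_zero_iff.2 x.2
  simp [smul_smul, hx]

variable [Nontrivial E]

theorem integral_polar (f : E → ℝ) :
    ∫ x, f x ∂μ = ∫ p : sphere (0 : E) 1 × Ioi (0 : ℝ), f (p.2.1 • p.1.1)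
      ∂(μ.toSphere.prod (Measure.volumeIoiPow (Module.finrank ℝ E - 1))) := by
  calc
    ∫ x, f x ∂μ = ∫ x : ({(0)}ᶜ : Set E), f x ∂(μ.comap (↑)) := by
      rw [integral_subtype_comap (measurableSet_singleton _).compl f, restrict_compl_singleton]
    _ = ∫ x : ({(0)}ᶜ : Set E), f ((homeomorphUnitSphereProd E x).2.1 •
          (homeomorphUnitSphereProd E x).1.1) ∂(μ.comap (↑)) := by
      congr 1 with x
      have hx : ‖(x : E)‖ ≠ 0 := norm_ne_zero_iff.2 x.2
      simp [smul_smul, hx]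
    _ = _ := μ.measurePreserving_homeomorphUnitSphereProd.integral_comp
      (homeomorphUnitSphereProd E).measurableEmbedding
      (fun p : sphere (0 : E) 1 × Ioi (0 : ℝ) ↦ f (p.2.1 • p.1.1))

theorem integral_eq_integral_sphere_integral_Ioi {f : E → ℝ} (hf : Integrable f μ) :
    ∫ x, f x ∂μ = ∫ ω : sphere (0 : E) 1,
      (∫ t in Ioi (0 : ℝ), t ^ (Module.finrank ℝ E - 1) * f (t • ω.1)) ∂μ.toSphere := by
  rw [integral_polar, integral_prod _ (integrable_polar μ hf)]
  exact integral_congr_ae (.of_forall fun ω ↦ integral_volumeIoiPow _ fun t ↦ f (t • ω.1))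

theorem integral_eq_integral_Ioi_integral_sphere {f : E → ℝ} (hf : Integrable f μ) :
    ∫ x, f x ∂μ = ∫ t in Ioi (0 : ℝ), t ^ (Module.finrank ℝ E - 1) *
      ∫ ω : sphere (0 : E) 1, f (t • ω.1) ∂μ.toSphere := by
  rw [integral_polar, integral_prod_symm _ (integrable_polar μ hf)]
  exact integral_volumeIoiPow _ fun t ↦ ∫ ω : sphere (0 : E) 1, f (t • ω.1) ∂μ.toSphere

omit [FiniteDimensional ℝ E] [BorelSpace E] [Nontrivial E] [MeasurableSpace E] in
theorem indicator_ball_smul (f : E → ℝ) (R : ℝ) {t : ℝ} (ht : 0 < t) (ω : sphere (0 : E) 1) :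
    (ball (0 : E) R).indicator f (t • ω.1) = (Iio R).indicator (fun t ↦ f (t • ω.1)) t := by
  have ht' : |t| = t := abs_of_pos ht
  by_cases htR : t < R <;> simp [indicator, norm_smul, ht', htR]

omit [FiniteDimensional ℝ E] [BorelSpace E] [Nontrivial E] in
theorem pow_mul_integral_sphere_indicator_ball (ν : Measure (sphere (0 : E) 1)) (f : E → ℝ)
    (R : ℝ) (n : ℕ) {t : ℝ} (ht : 0 < t) :
    t ^ n * ∫ ω : sphere (0 : E) 1, (ball (0 : E) R).indicator f (t • ω.1) ∂ν =
      (Iio R).indicator (fun t ↦ t ^ n * ∫ ω : sphere (0 : E) 1, f (t • ω.1) ∂ν) t := by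
  simp only [indicator_ball_smul f R ht]
  by_cases htR : t < R <;> simp [indicator, htR]

theorem setIntegral_ball_eq_integral_Ioo {f : E → ℝ} {R : ℝ}
    (hf : IntegrableOn f (ball 0 R) μ) :
    ∫ x in ball 0 R, f x ∂μ = ∫ t in Ioo 0 R, t ^ (Module.finrank ℝ E - 1) *
      ∫ ω : sphere (0 : E) 1, f (t • ω.1) ∂μ.toSphere := by
  rw [← integral_indicator measurableSet_ball, integral_eq_integral_Ioi_integral_sphere μ
    (hf.integrable_indicator measurableSet_ball), ← Ioi_inter_Iio,
    ← setIntegral_indicator measurableSet_Iio]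
  exact setIntegral_congr_fun measurableSet_Ioi fun t ht ↦
    pow_mul_integral_sphere_indicator_ball _ f R _ ht

omit [Nontrivial E] in
theorem integrableOn_Ioo_integral_sphere {f : E → ℝ} {R : ℝ}
    (hf : IntegrableOn f (ball 0 R) μ) :
    IntegrableOn (fun t ↦ t ^ (Module.finrank ℝ E - 1) *
      ∫ ω : sphere (0 : E) 1, f (t • ω.1) ∂μ.toSphere) (Ioo 0 R) := by
  have h := (integrable_polar μ (hf.integrable_indicator measurableSet_ball)).integral_prod_right
  have h' := (integrable_volumeIoiPow_iff (Module.finrank ℝ E - 1) fun t ↦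
    ∫ ω : sphere (0 : E) 1, (ball (0 : E) R).indicator f (t • ω.1) ∂μ.toSphere).1 h
  have h2 := h'.congr_fun
    (fun t ht ↦ pow_mul_integral_sphere_indicator_ball _ f R _ ht) measurableSet_Ioi
  rw [IntegrableOn, integrable_indicator_iff measurableSet_Iio, IntegrableOn,
    Measure.restrict_restrict measurableSet_Iio, inter_comm, Ioi_inter_Iio] at h2
  exact h2

/-- A radial function around an arbitrary centre is integrable on a ball if its profile is
integrable, with the polar weight, near the origin. -/
theorem integrableOn_ball_fun_norm_sub {g : ℝ → ℝ} (x : E) (R : ℝ)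
    (hg : ∀ A, IntegrableOn (fun t ↦ t ^ (Module.finrank ℝ E - 1) * g t) (Ioo 0 A)) :
    IntegrableOn (fun y ↦ g ‖x - y‖) (ball 0 R) μ := by
  -- The radius `‖x‖ + R` is large enough for the ball about `x` to contain `ball 0 R`.
  have h := (integrableOn_fun_norm_addHaar μ (f := g) (r := ‖x‖ + R)).2 (hg _)
  rw [← integrable_indicator_iff measurableSet_ball] at h
  have h2 := h.comp_sub_left x
  have h3 : IntegrableOn (fun y ↦ (ball (0 : E) (‖x‖ + R)).indicator (fun y ↦ g ‖y‖) (x - y))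
    (ball 0 R) μ := h2.integrableOn
  refine h3.congr_fun (fun y hy ↦ ?_) measurableSet_ball
  refine indicator_of_mem ?_ _
  rw [mem_ball_zero_iff] at hy ⊢
  linarith [norm_sub_le x y]

end Polar

/-! ### Second moments of the surface measure. -/

section Quadratic

variable {E : Type*} [NormedAddCommGroup E] [InnerProductSpace ℝ E] [MeasurableSpace E]
  [BorelSpace E] [FiniteDimensional ℝ E]

theorem integrable_sphere_of_continuous {f : sphere (0 : E) 1 → ℝ} (hf : Continuous f) :
    Integrable f (volume : Measure E).toSphere := by
  have : CompactSpace (sphere (0 : E) 1) := isCompact_iff_compactSpace.1 (isCompact_sphere _ _)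
  exact hf.integrable_of_hasCompactSupport (HasCompactSupport.of_compactSpace f)

variable [Nontrivial E]

/-- Homogeneity of degree two separates radius and direction. This lets the invariance of Lebesgue
measure under isometries pass to the surface measure. -/
theorem setIntegral_ball_inner_sq (x : E) :
    ∫ y in ball (0 : E) 1, ⟪x, y⟫ ^ 2 = (∫ ω : sphere (0 : E) 1, ⟪x, ω.1⟫ ^ 2
      ∂(volume : Measure E).toSphere) * ∫ t in Ioo (0 : ℝ) 1, t ^ (Module.finrank ℝ E + 1) := by
  have hn : 0 < Module.finrank ℝ E := Module.finrank_pos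
  rw [setIntegral_ball_eq_integral_Ioo volume, mul_comm, ← integral_mul_const]
  · refine setIntegral_congr_fun measurableSet_Ioo fun t ht ↦ ?_
    simp only [inner_smul_right, mul_pow]
    rw [integral_const_mul, ← mul_assoc, ← pow_add]
    congr 2; omega
  · exact ((Continuous.continuousOn (by fun_prop)).integrableOn_compact
      (isCompact_closedBall (0 : E) 1)).mono_set ball_subset_closedBall

theorem integral_sphere_inner_sq_eq_of_norm_eq {x y : E} (h : ‖x‖ = ‖y‖) :
    ∫ ω : sphere (0 : E) 1, ⟪x, ω.1⟫ ^ 2 ∂(volume : Measure E).toSphere =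
      ∫ ω : sphere (0 : E) 1, ⟪y, ω.1⟫ ^ 2 ∂(volume : Measure E).toSphere := by
  have hpos : ∫ t in Ioo (0 : ℝ) 1, t ^ (Module.finrank ℝ E + 1) ≠ 0 := by
    rw [← integral_Ioc_eq_integral_Ioo, ← intervalIntegral.integral_of_le zero_le_one,
      integral_pow]
    have : (0 : ℝ) < (Module.finrank ℝ E + 1 : ℕ) + 1 := by positivity
    rw [one_pow, zero_pow (Nat.succ_ne_zero _), sub_zero]
    exact (one_div_pos.2 (by exact_mod_cast this)).ne'
  refine mul_right_cancel₀ hpos ?_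
  rw [← setIntegral_ball_inner_sq, ← setIntegral_ball_inner_sq]
  -- Reflection in the hyperplane orthogonal to `x - y` exchanges the two vectors of equal norm.
  set T : E ≃ₗᵢ[ℝ] E := Submodule.reflection (ℝ ∙ (x - y))ᗮ
  have hT : T x = y := Submodule.reflection_sub h
  rw [← T.measurePreserving.setIntegral_preimage_emb
    T.toHomeomorph.measurableEmbedding (fun v ↦ ⟪y, v⟫ ^ 2)]
  have hpre : T ⁻¹' ball (0 : E) 1 = ball 0 1 := by
    ext v; simp
  rw [hpre, ← hT]
  simp

/-- All directions of length `‖x‖` give the same integral, and over an orthonormal basis the squared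
coordinates of `ω` sum to one. -/
theorem integral_sphere_inner_sq (x : E) :
    ∫ ω : sphere (0 : E) 1, ⟪x, ω.1⟫ ^ 2 ∂(volume : Measure E).toSphere =
      ‖x‖ ^ 2 / Module.finrank ℝ E * (volume : Measure E).toSphere.real univ := by
  have hn : (Module.finrank ℝ E : ℝ) ≠ 0 := by exact_mod_cast Module.finrank_pos.ne'
  let b := stdOrthonormalBasis ℝ E
  have h1 : ∀ i, ∫ ω : sphere (0 : E) 1, ⟪x, ω.1⟫ ^ 2 ∂(volume : Measure E).toSphere =
      ∫ ω : sphere (0 : E) 1, ‖x‖ ^ 2 * ⟪b i, ω.1⟫ ^ 2 ∂(volume : Measure E).toSphere := by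
    intro i
    rw [integral_sphere_inner_sq_eq_of_norm_eq (y := ‖x‖ • b i) (by simp [norm_smul])]
    simp [inner_smul_left, mul_pow]
  have h2 : ∑ i, ∫ ω : sphere (0 : E) 1, ‖x‖ ^ 2 * ⟪b i, ω.1⟫ ^ 2
      ∂(volume : Measure E).toSphere =
      ‖x‖ ^ 2 * (volume : Measure E).toSphere.real univ := by
    rw [← integral_finsetSum _ fun i _ ↦ integrable_sphere_of_continuous (by fun_prop)]
    simp_rw [← Finset.mul_sum]
    have : ∀ ω : sphere (0 : E) 1, ∑ i, ⟪b i, ω.1⟫ ^ 2 = 1 := by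
      intro ω
      have := b.sum_sq_norm_inner_right ω.1
      simpa using this
    simp [this, mul_comm]
  rw [← Finset.sum_congr rfl fun i _ ↦ h1 i] at h2
  simp only [Finset.sum_const, Finset.card_univ, Fintype.card_fin, nsmul_eq_mul] at h2
  field_simp
  linarith

end Quadratic

/-! ### Newton's theorem for the power kernel. -/

section Newton

variable {E : Type*} [NormedAddCommGroup E] [InnerProductSpace ℝ E] [MeasurableSpace E]
  [BorelSpace E] [FiniteDimensional ℝ E] [Nontrivial E]

omit [MeasurableSpace E] [BorelSpace E] in
theorem pow_finrank_sub_one_mul_rpow {t : ℝ} (ht : 0 < t) :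
    t ^ (Module.finrank ℝ E - 1) * t ^ (2 - (Module.finrank ℝ E : ℝ)) = t := by
  have hn : 1 ≤ Module.finrank ℝ E := Module.finrank_pos
  rw [← Real.rpow_natCast, ← Real.rpow_add ht, Nat.cast_sub hn]
  ring_nf
  exact Real.rpow_one t

theorem integrableOn_ball_norm_sub_rpow (x : E) (R : ℝ) :
    IntegrableOn (fun y ↦ ‖x - y‖ ^ (2 - (Module.finrank ℝ E : ℝ))) (ball 0 R) := by
  refine integrableOn_ball_fun_norm_sub volume (g := fun t ↦ t ^ (2 - (Module.finrank ℝ E : ℝ)))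
    x R fun A ↦ ?_
  have h : IntegrableOn (fun t : ℝ ↦ t) (Ioo 0 A) :=
    (continuous_id.continuousOn.integrableOn_compact isCompact_Icc).mono_set Ioo_subset_Icc_self
  exact h.congr_fun (fun t ht ↦ (pow_finrank_sub_one_mul_rpow ht.1).symm) measurableSet_Ioo

/-- The distance from `x` to the sphere of radius `R` in the direction `ω`. -/
noncomputable def exitTime (R : ℝ) (x ω : E) : ℝ :=
  -⟪x, ω⟫ + √(⟪x, ω⟫ ^ 2 + (R ^ 2 - ‖x‖ ^ 2))

omit [MeasurableSpace E] [BorelSpace E] [FiniteDimensional ℝ E] [Nontrivial E] in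
theorem add_smul_mem_ball_iff {R : ℝ} {x ω : E} (hx : ‖x‖ < R) (hω : ‖ω‖ = 1) {t : ℝ}
    (ht : 0 < t) : x + t • ω ∈ ball (0 : E) R ↔ t < exitTime R x ω := by
  have hR : 0 < R := (norm_nonneg x).trans_lt hx
  have hsq : ‖x + t • ω‖ ^ 2 = ‖x‖ ^ 2 + 2 * t * ⟪x, ω⟫ + t ^ 2 := by
    rw [norm_add_sq_real, inner_smul_right, norm_smul, hω, mul_one, Real.norm_eq_abs, sq_abs]
    ring
  have hpos : 0 < R ^ 2 - ‖x‖ ^ 2 := by nlinarith [norm_nonneg x]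
  rw [mem_ball_zero_iff, ← sq_lt_sq₀ (norm_nonneg _) hR.le, hsq, exitTime,
    ← sub_lt_iff_lt_add', sub_neg_eq_add]
  -- Completing the square compares `(t + ⟪x, ω⟫) ^ 2` with the radicand. If `t + ⟪x, ω⟫ < 0`, then
  -- `t > 0` makes the norm smaller than `‖x‖`, so both sides hold.
  rcases le_or_gt 0 (t + ⟪x, ω⟫) with h | h
  · rw [Real.lt_sqrt h]
    constructor <;> intro h' <;> nlinarith
  · refine iff_of_true (by nlinarith) (h.trans_le (Real.sqrt_nonneg _))

omit [MeasurableSpace E] [BorelSpace E] [FiniteDimensional ℝ E] [Nontrivial E] in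
theorem exitTime_nonneg {R : ℝ} {x : E} (hx : ‖x‖ < R) (ω : E) : 0 ≤ exitTime R x ω := by
  have hpos : 0 < R ^ 2 - ‖x‖ ^ 2 := by nlinarith [norm_nonneg x]
  have := Real.abs_le_sqrt (x := ⟪x, ω⟫) (y := ⟪x, ω⟫ ^ 2 + (R ^ 2 - ‖x‖ ^ 2)) (by linarith)
  rw [exitTime]
  linarith [le_abs_self ⟪x, ω⟫]

omit [MeasurableSpace E] [BorelSpace E] [FiniteDimensional ℝ E] [Nontrivial E] in
-- The cross terms `∓ 2 * ⟪x, ω⟫ * √…` have opposite signs and cancel.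
theorem exitTime_sq_add_exitTime_neg_sq {R : ℝ} {x : E} (hx : ‖x‖ < R) (ω : E) :
    exitTime R x ω ^ 2 + exitTime R (-x) ω ^ 2 =
      4 * ⟪x, ω⟫ ^ 2 + 2 * (R ^ 2 - ‖x‖ ^ 2) := by
  have hpos : 0 < R ^ 2 - ‖x‖ ^ 2 := by nlinarith [norm_nonneg x]
  simp only [exitTime, inner_neg_left, norm_neg, neg_sq, neg_neg]
  have := Real.sq_sqrt (x := ⟪x, ω⟫ ^ 2 + (R ^ 2 - ‖x‖ ^ 2)) (by positivity)
  linear_combination 2 * this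

theorem setIntegral_ball_norm_sub_rpow_eq_sphere {R : ℝ} {x : E} (hx : ‖x‖ < R) :
    ∫ y in ball (0 : E) R, ‖x - y‖ ^ (2 - (Module.finrank ℝ E : ℝ)) =
      ∫ ω : sphere (0 : E) 1, exitTime R x ω.1 ^ 2 / 2 ∂(volume : Measure E).toSphere := by
  have hint := (integrableOn_ball_norm_sub_rpow x R).integrable_indicator measurableSet_ball
  rw [← integral_indicator measurableSet_ball, ← integral_add_left_eq_self _ x,
    integral_eq_integral_sphere_integral_Ioi volume (hint.comp_add_left x)]
  refine integral_congr_ae (.of_forall fun ω ↦ ?_)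
  have hω : ‖ω.1‖ = 1 := by simp
  have h : ∀ t ∈ Ioi (0 : ℝ), t ^ (Module.finrank ℝ E - 1) *
      (ball (0 : E) R).indicator (fun y ↦ ‖x - y‖ ^ (2 - (Module.finrank ℝ E : ℝ)))
        (x + t • ω.1) = (Iio (exitTime R x ω.1)).indicator (fun t ↦ t) t := by
    intro t (ht : 0 < t)
    have hiff := add_smul_mem_ball_iff hx hω ht
    by_cases htR : t < exitTime R x ω.1
    · rw [indicator_of_mem (hiff.2 htR), indicator_of_mem (mem_Iio.2 htR), sub_add_cancel_left,
        norm_neg, norm_smul, hω, mul_one, Real.norm_of_nonneg ht.le,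
        pow_finrank_sub_one_mul_rpow ht]
    · rw [indicator_of_notMem (mt hiff.1 htR), indicator_of_notMem (by simpa using htR), mul_zero]
  simp only
  rw [setIntegral_congr_fun measurableSet_Ioi h, setIntegral_indicator measurableSet_Iio,
    Ioi_inter_Iio, ← integral_Ioc_eq_integral_Ioo,
    ← intervalIntegral.integral_of_le (exitTime_nonneg hx _), integral_id]
  ring

omit [Nontrivial E] in
theorem setIntegral_ball_norm_neg_sub_rpow (x : E) (R a : ℝ) :
    ∫ y in ball (0 : E) R, ‖-x - y‖ ^ a = ∫ y in ball (0 : E) R, ‖x - y‖ ^ a := by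
  rw [← (Measure.measurePreserving_neg (volume : Measure E)).setIntegral_preimage_emb
    (Homeomorph.neg E).measurableEmbedding (fun y ↦ ‖-x - y‖ ^ a)]
  have hpre : Neg.neg ⁻¹' ball (0 : E) R = ball 0 R := by ext v; simp
  rw [hpre]
  congr 1 with y
  rw [← norm_neg]
  congr 2
  abel

/-- The potential of a uniformly charged ball at an interior point, for the kernel
`‖x - y‖ ^ (2 - dim E)`. -/
theorem setIntegral_ball_norm_sub_rpow_of_norm_lt {R : ℝ} {x : E} (hx : ‖x‖ < R) :
    ∫ y in ball (0 : E) R, ‖x - y‖ ^ (2 - (Module.finrank ℝ E : ℝ)) =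
      (volume : Measure E).toSphere.real univ / 2 *
        (2 * ‖x‖ ^ 2 / Module.finrank ℝ E + (R ^ 2 - ‖x‖ ^ 2)) := by
  have h1 := setIntegral_ball_norm_sub_rpow_eq_sphere hx
  have h2 := setIntegral_ball_norm_sub_rpow_eq_sphere (x := -x) (R := R) (by simpa using hx)
  rw [setIntegral_ball_norm_neg_sub_rpow] at h2
  have hc (z : E) : Integrable (fun ω : sphere (0 : E) 1 ↦ exitTime R z ω.1 ^ 2 / 2)
      (volume : Measure E).toSphere :=
    integrable_sphere_of_continuous (by unfold exitTime; fun_prop)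
  have h3 : ∫ ω : sphere (0 : E) 1, (exitTime R x ω.1 ^ 2 / 2 + exitTime R (-x) ω.1 ^ 2 / 2)
      ∂(volume : Measure E).toSphere =
      ∫ ω : sphere (0 : E) 1, (2 * ⟪x, ω.1⟫ ^ 2 + (R ^ 2 - ‖x‖ ^ 2))
        ∂(volume : Measure E).toSphere := by
    congr 1 with ω
    linarith [exitTime_sq_add_exitTime_neg_sq hx ω.1]
  rw [integral_add (hc x) (hc (-x)), integral_add
    (integrable_sphere_of_continuous (by fun_prop)) (integrable_const _), integral_const_mul,
    integral_sphere_inner_sq, integral_const, smul_eq_mul] at h3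
  linear_combination (1 / 2) * h1 + (1 / 2) * h2 + (1 / 2) * h3

/-- The spherical mean of `‖z - ·‖ ^ (2 - dim E)` over a sphere enclosing `z`. -/
theorem integral_sphere_norm_sub_rpow {R : ℝ} {z : E} (hz : ‖z‖ < R) :
    ∫ ω : sphere (0 : E) 1, ‖z - R • ω.1‖ ^ (2 - (Module.finrank ℝ E : ℝ))
      ∂(volume : Measure E).toSphere =
      (volume : Measure E).toSphere.real univ * R ^ (2 - (Module.finrank ℝ E : ℝ)) := by
  have hR : 0 < R := (norm_nonneg z).trans_lt hz
  have : CompactSpace (sphere (0 : E) 1) := isCompact_iff_compactSpace.1 (isCompact_sphere _ _)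
  obtain ⟨a, hza, haR⟩ := exists_between hz
  have ha : 0 < a := (norm_nonneg z).trans_lt hza
  set n := Module.finrank ℝ E with hn
  set c := (volume : Measure E).toSphere.real univ
  set M : ℝ → ℝ := fun t ↦ ∫ ω : sphere (0 : E) 1, ‖z - t • ω.1‖ ^ (2 - (n : ℝ))
    ∂(volume : Measure E).toSphere with hM
  -- Truncating at `a`, strictly between `‖z‖` and `R`, keeps the spheres away from the singularity
  -- `z`, so the fundamental theorem of calculus applies at `R`.
  have hMcont : Continuous fun t ↦ M (max t a) := by
    have hf : Continuous (Function.uncurry fun (t : ℝ) (ω : sphere (0 : E) 1) ↦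
        ‖z - max t a • ω.1‖ ^ (2 - (n : ℝ))) := by
      refine Continuous.rpow_const (f := fun p : ℝ × sphere (0 : E) 1 ↦
        ‖z - max p.1 a • p.2.1‖) (by fun_prop) fun p ↦ Or.inl ?_
      have h1 : ‖max p.1 a • p.2.1‖ = max p.1 a := by
        rw [norm_smul, norm_eq_of_mem_sphere, mul_one,
          Real.norm_of_nonneg (ha.le.trans (le_max_right _ _))]
      have h2 := norm_sub_norm_le (max p.1 a • p.2.1) z
      rw [norm_sub_rev, h1] at h2
      have := le_max_right p.1 a
      exact ne_of_gt (by linarith)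
    have := continuous_parametric_integral_of_continuous (μ := (volume : Measure E).toSphere) hf
      isCompact_univ
    simpa [hM] using this
  set g : ℝ → ℝ := fun t ↦ t ^ (n - 1) * M (max t a) with hg
  have hgcont : Continuous g := (continuous_pow _).mul hMcont
  have hI (s : ℝ) : IntegrableOn (fun t ↦ t ^ (n - 1) * M t) (Ioo 0 s) :=
    integrableOn_Ioo_integral_sphere volume (integrableOn_ball_norm_sub_rpow z s)
  have hP (s : ℝ) (hs : ‖z‖ < s) : c / 2 * (2 * ‖z‖ ^ 2 / n + (s ^ 2 - ‖z‖ ^ 2)) =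
      ∫ t in (0 : ℝ)..s, t ^ (n - 1) * M t := by
    rw [intervalIntegral.integral_of_le ((norm_nonneg z).trans hs.le),
      integral_Ioc_eq_integral_Ioo,
      ← setIntegral_ball_eq_integral_Ioo volume (integrableOn_ball_norm_sub_rpow z s),
      setIntegral_ball_norm_sub_rpow_of_norm_lt hs]
  have hI' (s : ℝ) (hs : ‖z‖ < s) :
      IntervalIntegrable (fun t ↦ t ^ (n - 1) * M t) volume 0 s := by
    rw [intervalIntegrable_iff_integrableOn_Ioo_of_le ((norm_nonneg z).trans hs.le)]
    exact hI s
  have hG (s : ℝ) (hs : a < s) : ∫ t in a..s, g t =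
      c / 2 * (2 * ‖z‖ ^ 2 / n + (s ^ 2 - ‖z‖ ^ 2)) -
        c / 2 * (2 * ‖z‖ ^ 2 / n + (a ^ 2 - ‖z‖ ^ 2)) := by
    rw [hP s (hza.trans hs), hP a hza, intervalIntegral.integral_interval_sub_left
      (hI' s (hza.trans hs)) (hI' a hza)]
    refine intervalIntegral.integral_congr fun t ht ↦ ?_
    rw [uIcc_of_le hs.le] at ht
    simp [hg, max_eq_left ht.1]
  -- Differentiating the shell integral and its closed form at `R`: the terms in `‖z‖` are constant
  -- and drop out.
  have hd1 : HasDerivAt (fun s ↦ ∫ t in a..s, g t) (g R) R :=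
    hgcont.integral_hasStrictDerivAt a R |>.hasDerivAt
  have hd2 : HasDerivAt (fun s ↦ c / 2 * (2 * ‖z‖ ^ 2 / n + (s ^ 2 - ‖z‖ ^ 2)) -
      c / 2 * (2 * ‖z‖ ^ 2 / n + (a ^ 2 - ‖z‖ ^ 2))) (c * R) R := by
    have := ((((hasDerivAt_pow 2 R).sub_const (‖z‖ ^ 2)).const_add
      (2 * ‖z‖ ^ 2 / n)).const_mul (c / 2)).sub_const
      (c / 2 * (2 * ‖z‖ ^ 2 / n + (a ^ 2 - ‖z‖ ^ 2)))
    exact this.congr_deriv (by norm_num; ring)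
  have hd3 := hd2.congr_of_eventuallyEq (f₁ := fun s ↦ ∫ t in a..s, g t)
    ((lt_mem_nhds haR).mono fun s hs ↦ hG s hs)
  have key : R ^ (n - 1) * M R = c * R := by
    have := hd1.unique hd3
    simpa [hg, max_eq_left haR.le] using this
  have hR1 : R ^ (n - 1) ≠ 0 := by positivity
  refine mul_left_cancel₀ hR1 (key.trans ?_)
  rw [mul_left_comm, pow_finrank_sub_one_mul_rpow hR]

omit [MeasurableSpace E] [BorelSpace E] [FiniteDimensional ℝ E] [Nontrivial E] in
/-- The distance from `x` to `t • ω` is symmetric under exchange of the two radii. -/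
theorem norm_sub_smul_eq_norm_smul_sub {x ω : E} (hx : x ≠ 0) (hω : ‖ω‖ = 1) (t : ℝ) :
    ‖x - t • ω‖ = ‖(t / ‖x‖) • x - ‖x‖ • ω‖ := by
  have hx' : ‖x‖ ≠ 0 := norm_ne_zero_iff.2 hx
  rw [← sq_eq_sq₀ (norm_nonneg _) (norm_nonneg _), norm_sub_sq_real, norm_sub_sq_real]
  simp only [inner_smul_left, inner_smul_right, norm_smul, hω, norm_div, mul_pow,
    div_pow, Real.norm_eq_abs, sq_abs, RCLike.conj_to_real]
  field_simp
  ring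

/-- The potential of a uniformly charged ball at an exterior point, for the kernel
`‖x - y‖ ^ (2 - dim E)`. -/
theorem setIntegral_ball_norm_sub_rpow_of_le_norm {R : ℝ} (hR : 0 < R) {x : E} (hx : R ≤ ‖x‖) :
    ∫ y in ball (0 : E) R, ‖x - y‖ ^ (2 - (Module.finrank ℝ E : ℝ)) =
      (volume : Measure E).toSphere.real univ * R ^ Module.finrank ℝ E / Module.finrank ℝ E *
        ‖x‖ ^ (2 - (Module.finrank ℝ E : ℝ)) := by
  have hx0 : x ≠ 0 := norm_pos_iff.1 (hR.trans_le hx)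
  have hxp : 0 < ‖x‖ := hR.trans_le hx
  have hn : 1 ≤ Module.finrank ℝ E := Module.finrank_pos
  rw [setIntegral_ball_eq_integral_Ioo volume (integrableOn_ball_norm_sub_rpow x R)]
  have h : ∀ t ∈ Ioo 0 R, t ^ (Module.finrank ℝ E - 1) *
      ∫ ω : sphere (0 : E) 1, ‖x - t • ω.1‖ ^ (2 - (Module.finrank ℝ E : ℝ))
        ∂(volume : Measure E).toSphere =
      t ^ (Module.finrank ℝ E - 1) * ((volume : Measure E).toSphere.real univ *
        ‖x‖ ^ (2 - (Module.finrank ℝ E : ℝ))) := by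
    intro t ht
    -- The rescaled point has norm `t < R ≤ ‖x‖`, strictly inside the sphere of radius `‖x‖` even
    -- when `x` lies on the boundary.
    have hnorm : ‖(t / ‖x‖) • x‖ < ‖x‖ := by
      rw [norm_smul, norm_div, norm_norm, div_mul_cancel₀ _ hxp.ne', Real.norm_of_nonneg ht.1.le]
      exact ht.2.trans_le hx
    rw [← integral_sphere_norm_sub_rpow hnorm]
    congr 2 with ω
    rw [norm_sub_smul_eq_norm_smul_sub hx0 (by simp) t]
  rw [setIntegral_congr_fun measurableSet_Ioo h, integral_mul_const,
    ← integral_Ioc_eq_integral_Ioo, ← intervalIntegral.integral_of_le hR.le, integral_pow,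
    Nat.sub_add_cancel hn, zero_pow (by omega), Nat.cast_sub hn]
  push_cast
  ring

end Newton

/-! ### The logarithmic kernel in the plane. -/

section Plane

open Real

theorem integrableOn_polarCoord_target {f : ℂ → ℝ} (hf : Integrable f) :
    IntegrableOn (fun p : ℝ × ℝ ↦ p.1 * f (Complex.polarCoord.symm p)) polarCoord.target := by
  have h1 : Integrable (f ∘ Complex.measurableEquivRealProd.symm) :=
    (Complex.volume_preserving_equiv_real_prod.symm.integrable_comp_emb
      Complex.measurableEquivRealProd.symm.measurableEmbedding).2 hf
  have h2 : IntegrableOn (f ∘ Complex.measurableEquivRealProd.symm)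
    (polarCoord.symm '' polarCoord.target) := h1.integrableOn
  rw [integrableOn_image_iff_integrableOn_abs_det_fderiv_smul volume
    polarCoord.open_target.measurableSet
    (fun p _ ↦ (hasFDerivAt_polarCoord_symm p).hasFDerivWithinAt) polarCoord.symm.injOn] at h2
  refine h2.congr_fun (fun p hp ↦ ?_) polarCoord.open_target.measurableSet
  simp only
  rw [det_fderivPolarCoordSymm, abs_of_pos hp.1, smul_eq_mul, Function.comp_apply,
    Complex.measurableEquivRealProd_symm_polarCoord_symm_apply]

theorem integral_complex_eq_integral_circleAverage {f : ℂ → ℝ} (hf : Integrable f) :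
    ∫ z, f z = ∫ t in Ioi (0 : ℝ), t * (2 * π * circleAverage f 0 t) := by
  rw [← Complex.integral_comp_polarCoord_symm]
  simp only [smul_eq_mul]
  have h := integrableOn_polarCoord_target hf
  rw [polarCoord_target, Measure.volume_eq_prod] at h ⊢
  rw [setIntegral_prod _ h]
  refine setIntegral_congr_fun measurableSet_Ioi fun t ht ↦ ?_
  simp only
  rw [integral_const_mul, circleAverage_def, smul_eq_mul, mul_inv_cancel_left₀ two_pi_pos.ne',
    ← integral_Ioc_eq_integral_Ioo, ← intervalIntegral.integral_of_le (by linarith [pi_pos])]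
  -- Periodicity moves the angular window from `(-π, π)` to `(0, 2π)`.
  have hper : (fun θ ↦ f (circleMap 0 t θ)).Periodic (2 * π) := fun θ ↦ by
    simp only [periodic_circleMap 0 t θ]
  have h2 := hper.intervalIntegral_add_eq (-π) 0
  rw [zero_add, show -π + 2 * π = π by ring] at h2
  rw [← h2]
  congr 1
  refine intervalIntegral.integral_congr fun θ _ ↦ ?_
  simp only [Complex.polarCoord_symm_apply, circleMap, zero_add, Complex.exp_mul_I,
    Complex.ofReal_cos, Complex.ofReal_sin]

theorem circleAverage_log_norm_sub {t : ℝ} (ht : 0 < t) (a : ℂ) :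
    circleAverage (fun z ↦ log ‖a - z‖) 0 t = log (max t ‖a‖) := by
  have h := circleAverage_log_norm_sub_const_eq_log_radius_add_posLog (c := 0) (a := a) ht.ne'
  have hmax : 0 < max 1 (t⁻¹ * ‖a‖) := lt_max_of_lt_left one_pos
  rw [zero_sub, norm_neg, posLog_eq_log_max_one (by positivity),
    ← log_mul ht.ne' hmax.ne', mul_max_of_nonneg _ _ ht.le, mul_one,
    mul_inv_cancel_left₀ ht.ne'] at h
  simpa only [norm_sub_rev a] using h

theorem integrableOn_Ioo_mul_log (A : ℝ) : IntegrableOn (fun t : ℝ ↦ t * log t) (Ioo 0 A) :=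
  (continuous_mul_log.continuousOn.integrableOn_compact isCompact_Icc).mono_set
    Ioo_subset_Icc_self

theorem integrableOn_ball_log_norm_sub (a : ℂ) (R : ℝ) :
    IntegrableOn (fun z ↦ log ‖a - z‖) (ball 0 R) := by
  refine integrableOn_ball_fun_norm_sub volume (g := log) a R fun A ↦ ?_
  simpa using integrableOn_Ioo_mul_log A

theorem setIntegral_ball_log_norm_sub (a : ℂ) (R : ℝ) :
    ∫ z in ball (0 : ℂ) R, log ‖a - z‖ =
      ∫ t in Ioo 0 R, t * (2 * π * log (max t ‖a‖)) := by
  rw [← integral_indicator measurableSet_ball, integral_complex_eq_integral_circleAverage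
    ((integrableOn_ball_log_norm_sub a R).integrable_indicator measurableSet_ball),
    ← Ioi_inter_Iio, ← setIntegral_indicator measurableSet_Iio]
  refine setIntegral_congr_fun measurableSet_Ioi fun t (ht : 0 < t) ↦ ?_
  have hmem (θ : ℝ) : circleMap 0 t θ ∈ ball (0 : ℂ) R ↔ t < R := by
    rw [mem_ball_zero_iff, norm_circleMap_zero, abs_of_pos ht]
  by_cases htR : t < R
  · simp only [indicator_of_mem (mem_Iio.2 htR)]
    rw [← circleAverage_log_norm_sub ht]
    simp [circleAverage_def, indicator, hmem, htR]
  · simp [circleAverage_def, indicator, hmem, htR]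

theorem setIntegral_ball_log_norm_sub_of_le_norm {R : ℝ} (hR : 0 < R) {a : ℂ} (ha : R ≤ ‖a‖) :
    ∫ z in ball (0 : ℂ) R, log ‖a - z‖ = π * R ^ 2 * log ‖a‖ := by
  have h : ∀ t ∈ Ioo 0 R, t * (2 * π * log (max t ‖a‖)) = t * (2 * π * log ‖a‖) :=
    fun t ht ↦ by rw [max_eq_right (ht.2.le.trans ha)]
  rw [setIntegral_ball_log_norm_sub, setIntegral_congr_fun measurableSet_Ioo h,
    integral_mul_const, ← integral_Ioc_eq_integral_Ioo, ← intervalIntegral.integral_of_le hR.le,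
    integral_id]
  ring

theorem integral_mul_log {r R : ℝ} (hr : 0 ≤ r) (hrR : r ≤ R) :
    ∫ t in r..R, t * log t =
      (R ^ 2 / 2 * log R - R ^ 2 / 4) - (r ^ 2 / 2 * log r - r ^ 2 / 4) := by
  refine intervalIntegral.integral_eq_sub_of_hasDerivAt_of_le
    (f := fun t ↦ t ^ 2 / 2 * log t - t ^ 2 / 4) hrR ?_ (fun t ht ↦ ?_)
    (continuous_mul_log.intervalIntegrable _ _)
  -- Factoring out `t * log t` gives continuity at `0`, needed because `r = 0` is allowed.
  · have : Continuous fun t : ℝ ↦ t / 2 * (t * log t) - t ^ 2 / 4 :=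
      (by fun_prop : Continuous fun t : ℝ ↦ t / 2).mul continuous_mul_log |>.sub (by fun_prop)
    exact (this.congr fun t ↦ by ring).continuousOn
  · have ht0 : t ≠ 0 := (hr.trans_lt ht.1).ne'
    have := (((hasDerivAt_pow 2 t).div_const 2).mul (hasDerivAt_log ht0)).sub
      ((hasDerivAt_pow 2 t).div_const 4)
    exact this.congr_deriv (by field_simp; ring)

theorem setIntegral_ball_log_norm_sub_of_norm_lt {R : ℝ} {a : ℂ} (ha : ‖a‖ < R) :
    ∫ z in ball (0 : ℂ) R, log ‖a - z‖ = π * R ^ 2 * log R - π / 2 * (R ^ 2 - ‖a‖ ^ 2) := by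
  have hR : 0 < R := (norm_nonneg a).trans_lt ha
  -- The radial integral splits at `‖a‖`, where the maximum changes branch.
  have h1 : EqOn (fun t ↦ 2 * π * log ‖a‖ * t) (fun t ↦ t * (2 * π * log (max t ‖a‖)))
      (uIcc 0 ‖a‖) := fun t ht ↦ by
    rw [uIcc_of_le (norm_nonneg a)] at ht
    simp only [max_eq_right ht.2]
    ring
  have h2 : EqOn (fun t ↦ 2 * π * (t * log t)) (fun t ↦ t * (2 * π * log (max t ‖a‖)))
      (uIcc ‖a‖ R) := fun t ht ↦ by
    rw [uIcc_of_le ha.le] at ht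
    simp only [max_eq_left ht.1]
    ring
  have hi1 : IntervalIntegrable (fun t ↦ 2 * π * log ‖a‖ * t) volume 0 ‖a‖ :=
    Continuous.intervalIntegrable (by fun_prop) _ _
  have hi2 : IntervalIntegrable (fun t ↦ 2 * π * (t * log t)) volume ‖a‖ R :=
    (continuous_const.mul continuous_mul_log).intervalIntegrable _ _
  rw [setIntegral_ball_log_norm_sub, ← integral_Ioc_eq_integral_Ioo,
    ← intervalIntegral.integral_of_le hR.le, ← intervalIntegral.integral_add_adjacent_intervals
      (hi1.congr (h1.mono uIoc_subset_uIcc)) (hi2.congr (h2.mono uIoc_subset_uIcc)),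
    ← intervalIntegral.integral_congr h1, ← intervalIntegral.integral_congr h2,
    intervalIntegral.integral_const_mul, intervalIntegral.integral_const_mul, integral_id,
    integral_mul_log (norm_nonneg a) ha.le]
  ring

theorem setIntegral_ball_log_norm_sub_euclidean (x : EuclideanSpace ℝ (Fin 2)) (R : ℝ) :
    ∫ y in ball (0 : EuclideanSpace ℝ (Fin 2)) R, log ‖x - y‖ =
      ∫ z in ball (0 : ℂ) R, log ‖Complex.orthonormalBasisOneI.repr.symm x - z‖ := by
  set T := Complex.orthonormalBasisOneI.repr.symm
  rw [← T.measurePreserving.setIntegral_preimage_emb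
    T.toHomeomorph.measurableEmbedding (fun z ↦ log ‖T x - z‖)]
  have hpre : T ⁻¹' ball (0 : ℂ) R = ball 0 R := by
    ext v; simp
  rw [hpre]
  simp only [← map_sub, T.norm_map]

end Plane

/-! ### Normalising constants and the Coulomb kernel in every dimension. -/

section Constants

theorem sphereArea_eq_toSphere {d : ℕ} (hd : 1 ≤ d) :
    sphereArea d = (volume : Measure (EuclideanSpace ℝ (Fin d))).toSphere.real univ := by
  have : Nonempty (Fin d) := Fin.pos_iff_nonempty.1 hd
  have hd' : (0 : ℝ) < d := by exact_mod_cast hd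
  have hG : 0 < Real.Gamma ((d : ℝ) / 2) := Real.Gamma_pos_of_pos (by positivity)
  rw [Measure.toSphere_real_apply_univ, finrank_euclideanSpace_fin, sphereArea, measureReal_def,
    EuclideanSpace.volume_ball, Fintype.card_fin, Real.Gamma_add_one (by positivity),
    ENNReal.ofReal_one, one_pow, one_mul, ENNReal.toReal_ofReal (by positivity),
    Real.sqrt_eq_rpow, ← Real.rpow_mul_natCast Real.pi_pos.le]
  rw [show (1 / 2 : ℝ) * d = d / 2 by ring]
  field_simp

theorem volume_real_ball {d : ℕ} (hd : 1 ≤ d) {R : ℝ} (hR : 0 < R) :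
    volume.real (ball (0 : EuclideanSpace ℝ (Fin d)) R) = sphereArea d * R ^ d / d := by
  have hd' : (d : ℝ) ≠ 0 := by positivity
  rw [sphereArea_eq_toSphere hd, Measure.toSphere_real_apply_univ, finrank_euclideanSpace_fin,
    measureReal_def, measureReal_def, Measure.addHaar_ball_of_pos _ _ hR, ENNReal.toReal_mul,
    finrank_euclideanSpace_fin, ENNReal.toReal_ofReal (by positivity)]
  field_simp

theorem sphereArea_two : sphereArea 2 = 2 * Real.pi := by
  simp [sphereArea]

theorem radialPhi_two (r : ℝ) : radialPhi 2 r = -Real.log r := by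
  simp [radialPhi]

/-- Away from dimension two, the Coulomb potential is `±r ^ (2 - d)`. -/
theorem exists_radialPhi_eq_mul_rpow {d : ℕ} (hd : 1 ≤ d) (hd2 : d ≠ 2) :
    ∃ σ : ℝ, chi d = σ * (d - 2) ∧ ∀ r, radialPhi d r = σ * r ^ (2 - (d : ℝ)) := by
  rcases hd.eq_or_lt with rfl | h
  -- The sign is `χ_d / (d - 2)`, hence `-1` in dimension one.
  · refine ⟨-1, by norm_num [chi], fun r ↦ ?_⟩
    norm_num [radialPhi]
  · have h3 : 2 < d := by omega
    refine ⟨1, by simp [chi, h3], fun r ↦ ?_⟩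
    simp [radialPhi, hd2, not_lt.2 h3.le]

theorem integrableOn_ball_Phi {d : ℕ} (hd : 1 ≤ d) (x : EuclideanSpace ℝ (Fin d)) (R : ℝ) :
    IntegrableOn (Phi x) (ball 0 R) := by
  have : Nonempty (Fin d) := Fin.pos_iff_nonempty.1 hd
  rcases eq_or_ne d 2 with rfl | hd2
  · refine integrableOn_ball_fun_norm_sub volume (g := radialPhi 2) x R fun A ↦ ?_
    simpa [radialPhi_two] using (integrableOn_Ioo_mul_log A).neg
  · obtain ⟨σ, -, hσ⟩ := exists_radialPhi_eq_mul_rpow hd hd2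
    have h := (integrableOn_ball_norm_sub_rpow x R).const_mul σ
    simp only [finrank_euclideanSpace_fin, ← hσ] at h
    exact h

theorem setIntegral_ball_Phi_of_norm_lt {d : ℕ} (hd : 1 ≤ d) {R : ℝ}
    {x : EuclideanSpace ℝ (Fin d)} (hx : ‖x‖ < R) :
    ∫ y in ball 0 R, Phi x y =
      sphereArea d * R ^ d / d * radialPhi d R -
        sphereArea d * chi d / (2 * d) * (‖x‖ ^ 2 - R ^ 2) := by
  have : Nonempty (Fin d) := Fin.pos_iff_nonempty.1 hd
  have hR : 0 < R := (norm_nonneg x).trans_lt hx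
  rcases eq_or_ne d 2 with rfl | hd2
  · simp only [Phi, radialPhi_two, sphereArea_two, chi, lt_irrefl, if_false]
    rw [integral_neg, setIntegral_ball_log_norm_sub_euclidean,
      setIntegral_ball_log_norm_sub_of_norm_lt (by rwa [LinearIsometryEquiv.norm_map]), LinearIsometryEquiv.norm_map]
    push_cast
    ring
  · obtain ⟨σ, hchi, hσ⟩ := exists_radialPhi_eq_mul_rpow hd hd2
    have hd' : (d : ℝ) ≠ 0 := by positivity
    have h := setIntegral_ball_norm_sub_rpow_of_norm_lt hx
    rw [finrank_euclideanSpace_fin, ← sphereArea_eq_toSphere hd] at h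
    have hpow : R ^ d * R ^ (2 - (d : ℝ)) = R ^ 2 := by
      rw [← Real.rpow_natCast, ← Real.rpow_add hR, add_sub_cancel, Real.rpow_two]
    simp only [Phi, hσ, hchi]
    rw [integral_const_mul, h]
    field_simp
    linear_combination (-2 * σ * sphereArea d) * hpow

theorem setIntegral_ball_Phi_of_le_norm {d : ℕ} (hd : 1 ≤ d) {R : ℝ} (hR : 0 < R)
    {x : EuclideanSpace ℝ (Fin d)} (hx : R ≤ ‖x‖) :
    ∫ y in ball 0 R, Phi x y = sphereArea d * R ^ d / d * radialPhi d ‖x‖ := by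
  have : Nonempty (Fin d) := Fin.pos_iff_nonempty.1 hd
  rcases eq_or_ne d 2 with rfl | hd2
  · simp only [Phi, radialPhi_two, sphereArea_two]
    rw [integral_neg, setIntegral_ball_log_norm_sub_euclidean,
      setIntegral_ball_log_norm_sub_of_le_norm hR (by rwa [LinearIsometryEquiv.norm_map]),
      LinearIsometryEquiv.norm_map]
    push_cast
    ring
  · obtain ⟨σ, -, hσ⟩ := exists_radialPhi_eq_mul_rpow hd hd2
    have h := setIntegral_ball_norm_sub_rpow_of_le_norm hR hx
    rw [finrank_euclideanSpace_fin, ← sphereArea_eq_toSphere hd] at h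
    simp only [Phi, hσ]
    rw [integral_const_mul, h]
    ring

end Constants

end CoulombGas

theorem proposition3p1 (d : ℕ) (hd : 1 ≤ d) (R : ℝ) (hR : 0 < R) (ρ N : ℝ)
    (hN : ρ * MeasureTheory.volume.real (Metric.ball (0 : EuclideanSpace ℝ (Fin d)) R) = N) :
    (∀ x : EuclideanSpace ℝ (Fin d),
      MeasureTheory.IntegrableOn (fun x' => CoulombGas.Phi x x' * (-ρ))
        (Metric.ball (0 : EuclideanSpace ℝ (Fin d)) R)) ∧
    (∀ x ∈ Metric.ball (0 : EuclideanSpace ℝ (Fin d)) R,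
      CoulombGas.potential (Metric.ball 0 R) (fun _ => -ρ) x =
        ρ * (CoulombGas.sphereArea d * CoulombGas.chi d / (2 * (d : ℝ))) * (‖x‖ ^ 2 - R ^ 2)
          - N * CoulombGas.radialPhi d R) ∧
    (∀ x ∉ Metric.ball (0 : EuclideanSpace ℝ (Fin d)) R,
      CoulombGas.potential (Metric.ball 0 R) (fun _ => -ρ) x =
        -N * CoulombGas.radialPhi d ‖x‖) := by
  rw [CoulombGas.volume_real_ball hd hR] at hN
  refine ⟨fun x ↦ (CoulombGas.integrableOn_ball_Phi hd x R).mul_const _, fun x hx ↦ ?_,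
    fun x hx ↦ ?_⟩
  · rw [mem_ball_zero_iff] at hx
    rw [CoulombGas.potential, integral_mul_const, CoulombGas.setIntegral_ball_Phi_of_norm_lt hd hx,
      ← hN]
    ring
  · rw [mem_ball_zero_iff, not_lt] at hx
    rw [CoulombGas.potential, integral_mul_const,
      CoulombGas.setIntegral_ball_Phi_of_le_norm hd hR hx, ← hN]
    ring
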